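/- Let $(\mathcal H,(\cdot,\cdot),\|\cdot\|)$ be a separable real Hilbert space with an orthogonal decomposition $\mathcal H=\mathcal H_0\oplus\mathcal H_1$ into closed subspaces, $\dim\mathcal H_0=m<\infty$, $\dim\mathcal H_1=\infty$. Let $\chi_1$ be the orthogonal projection onto $\mathcal H_1$ and $\|\mu\|_1:=\|\chi_1\mu\|$. Let $\mathcal I\subset\mathbb R^d$, let $(L_t)_{t\in\mathcal I}$ be bounded linear functionals on $\mathcal H$ with $\|L_s-L_t\|_{\mathcal H^*}\to0$ as $s\to t$ in $\mathcal I$, let $\phi_T$ be a Borel probability measure on $\mathcal I$, and let $\phi_0$ be a probability measure on $\mathbb R$ with mean $0$ and finite variance $\sigma^2$. Fix $\mu^\dagger\in\mathcal H$. On a probability space $(\Omega,\mathcal F,\mathbb P)$ let $(t_i)_{i\ge1}$ be i.i.d. with law $\phi_T$ and $(\epsilon_i)_{i\ge1}$ be i.i.d. with law $\phi_0$, the two sequences being independent of each other, and put $L_i=L_{t_i}$ and $y_i=L_i\mu^\dagger+\epsilon_i$. Let $\lambda_n=n^{-p}$ with $0<p\le\frac12$, and define $$f_n^{(\omega)}(\mu)=\frac1n\sum_{i=1}^n(y_i-L_i\mu)^2+\lambda_n\|\mu\|_1^2,\qquad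 f_\infty(\mu)=\int_{\mathcal I}\int_{-\infty}^{\infty}|y-L_t\mu|^2\,\phi_{L_t\mu^\dagger}(\mathrm dy)\,\phi_T(\mathrm dt)\in[0,\infty],$$ where, for $a\in\mathbb R$, $\phi_a$ denotes the law of $a+\epsilon$ with $\epsilon\sim\phi_0$. Then for $\mathbb P$-almost every $\omega$ the functionals $f_n^{(\omega)}$ $\Gamma$-converge to $f_\infty$ with respect to weak convergence on $\mathcal H$. That is, there is a single event of probability one on which, for every $\nu\in\mathcal H$: (i) $f_\infty(\nu)\le\liminf_{n\to\infty}f_n^{(\omega)}(\nu^n)$ for every sequence $(\nu^n)$ converging weakly to $\nu$; (ii) there is a sequence $(\nu^n)$ converging weakly to $\nu$ with $\limsup_{n\to\infty}f_n^{(\omega)}(\nu^n)\le f_\infty(\nu)$. -/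

import Mathlib

open MeasureTheory ProbabilityTheory Filter Topology

noncomputable section

/-- Weak convergence of a sequence `u` to `x` in a real normed space: convergence in the weak
topology, i.e. of all the values of bounded linear functionals. -/
def WeaklyConverges {E : Type*} [NormedAddCommGroup E] [NormedSpace ℝ E]
    (u : ℕ → E) (x : E) : Prop :=
  Tendsto (fun n => toWeakSpace ℝ E (u n)) atTop (𝓝 (toWeakSpace ℝ E x))

/-- `Γ`-convergence of the sequence `f n` of extended real-valued functionals to `fInf` with respect
to weak convergence. -/
def GammaConverges {E : Type*} [NormedAddCommGroup E] [NormedSpace ℝ E]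
    (f : ℕ → E → EReal) (fInf : E → EReal) : Prop :=
  ∀ v : E,
    (∀ u : ℕ → E, WeaklyConverges u v → fInf v ≤ liminf (fun n => f n (u n)) atTop) ∧
    (∃ u : ℕ → E, WeaklyConverges u v ∧ limsup (fun n => f n (u n)) atTop ≤ fInf v)

/-- The empirical spline functional built from the first `n` observations `(L (t i), y i)`,
`(1 / n) * ∑ (y i - L (t i) μ) ^ 2 + lam * ‖μ‖₁ ^ 2`, where `‖μ‖₁` is the norm of the orthogonal
projection of `μ` to `H₁`. The observations are numbered from `0`. -/
def splineFunctional {H : Type*} [NormedAddCommGroup H] [InnerProductSpace ℝ H]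
    (H₁ : Submodule ℝ H) [CompleteSpace H₁] {T : Type*} (L : T → H →L[ℝ] ℝ)
    (n : ℕ) (lam : ℝ) (t : ℕ → T) (y : ℕ → ℝ) (μ : H) : ℝ :=
  (1 / (n : ℝ)) * ∑ i ∈ Finset.range n, (y i - L (t i) μ) ^ 2
    + lam * ‖H₁.starProjection μ‖ ^ 2

/-- The law of `a + ε`, where `ε` has law `φ₀`. -/
def shiftedLaw (φ₀ : Measure ℝ) (a : ℝ) : Measure ℝ :=
  φ₀.map (fun e => a + e)

/-- The limit functional `∫∫ |y - L t μ| ^ 2 φ_{L t μ†}(dy) φ_T(dt)`, the integral of a nonnegative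
function, with value in `[0, ∞]`. -/
def splineLimit {H : Type*} [NormedAddCommGroup H] [InnerProductSpace ℝ H]
    {T : Type*} [MeasurableSpace T] (L : T → H →L[ℝ] ℝ)
    (φT : Measure T) (φ₀ : Measure ℝ) (μdag μ : H) : EReal :=
  ((∫⁻ t, ∫⁻ y, ENNReal.ofReal (|y - L t μ| ^ 2) ∂(shiftedLaw φ₀ (L t μdag)) ∂φT : ENNReal) : EReal)

end

/-! With `r_v(t, e) = e + L_t(μ† - v)`, the functional `f_n` is the empirical mean of `r_v ^ 2` plus
the penalty, and `f_∞(v)` is the integral of `r_v ^ 2` against `φT.prod φ₀`. Lower bound: a weakly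
convergent sequence is bounded, so norm continuity of `L` makes the `|r_{u n}|` equicontinuous, with
pointwise limit `|r_v|`. Almost surely the empirical measures converge weakly, and a Fatou lemma for
varying measures (`lintegral_le_liminf_of_equicontinuous`) concludes; the nonnegative penalty is
dropped. Recovery: the null set in the law of large numbers depends on `v`, so only countably many
candidates can be treated at once. Since `L` may be unbounded, `f_∞` can be infinite and
discontinuous, and density in `H` is not enough. Density in the graph norm of `v ↦ r_v ∈ L²` is
(`exists_countable_dense_memLp_two`). A diagonal sequence of such candidates recovers `f_∞(v)`, as
`λ_n → 0` removes the penalty. -/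

/-! ### Empirical measures and the law of large numbers. -/

/-- The empirical measure of the first `n` terms of a sequence. -/
noncomputable def empiricalMeasure {E : Type*} [MeasurableSpace E] (x : ℕ → E) (n : ℕ) : Measure E :=
  (n : ENNReal)⁻¹ • ∑ i ∈ Finset.range n, Measure.dirac (x i)

theorem lintegral_empiricalMeasure {E : Type*} [MeasurableSpace E] (x : ℕ → E) {n : ℕ}
    (hn : n ≠ 0) {f : E → ℝ} (hf : Measurable f) (hf0 : ∀ z, 0 ≤ f z) :
    ∫⁻ z, ENNReal.ofReal (f z) ∂(empiricalMeasure x n)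
      = ENNReal.ofReal ((∑ i ∈ Finset.range n, f (x i)) / n) := by
  have hn' : (0 : ℝ) < n := by positivity
  rw [empiricalMeasure, lintegral_smul_measure, lintegral_finsetSum_measure,
    ENNReal.ofReal_div_of_pos hn', ENNReal.ofReal_sum_of_nonneg (fun i _ => hf0 _),
    ENNReal.ofReal_natCast, ENNReal.div_eq_inv_mul, smul_eq_mul]
  simp_rw [lintegral_dirac' _ hf.ennreal_ofReal]

theorem empiricalMeasure_apply {E : Type*} [MeasurableSpace E] (x : ℕ → E) {n : ℕ}
    (hn : n ≠ 0) {s : Set E} (hs : MeasurableSet s) :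
    empiricalMeasure x n s
      = ENNReal.ofReal ((∑ i ∈ Finset.range n, s.indicator (fun _ => (1 : ℝ)) (x i)) / n) := by
  rw [← lintegral_empiricalMeasure x hn (measurable_const.indicator hs)
    (fun z => Set.indicator_nonneg (fun _ _ => zero_le_one) z), ← lintegral_indicator_one hs]
  congr 1 with z
  by_cases hz : z ∈ s <;> simp [hz]

/-- The strong law of large numbers for a function of pairwise independent random elements with a
common law. -/
theorem ae_tendsto_average {Ω E : Type*} [MeasurableSpace Ω] [MeasurableSpace E] {P : Measure Ω}
    {Q : Measure E} {X : ℕ → Ω → E} (hX : ∀ i, Measurable (X i)) (hlaw : ∀ i, P.map (X i) = Q)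
    (hindep : Pairwise fun i j => IndepFun (X i) (X j) P) {f : E → ℝ} (hf : Measurable f)
    (hfi : Integrable f Q) :
    ∀ᵐ ω ∂P, Tendsto (fun n : ℕ => (∑ i ∈ Finset.range n, f (X i ω)) / n) atTop
      (𝓝 (∫ z, f z ∂Q)) := by
  have h := strong_law_ae_real (μ := P) (fun i ω => f (X i ω))
    (by
      rw [← hlaw 0] at hfi
      exact hfi.comp_measurable (hX 0))
    (fun i j hij => (hindep hij).comp hf hf)
    (fun i => IdentDistrib.comp
      ⟨(hX i).aemeasurable, (hX 0).aemeasurable, by rw [hlaw, hlaw]⟩ hf)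
  rwa [← hlaw 0, integral_map (hX 0).aemeasurable hf.aestronglyMeasurable]

theorem ae_tendsto_empiricalMeasure {Ω E : Type*} [MeasurableSpace Ω] [MeasurableSpace E]
    {P : Measure Ω} {Q : Measure E} [IsFiniteMeasure Q] {X : ℕ → Ω → E}
    (hX : ∀ i, Measurable (X i)) (hlaw : ∀ i, P.map (X i) = Q)
    (hindep : Pairwise fun i j => IndepFun (X i) (X j) P) {s : Set E} (hs : MeasurableSet s) :
    ∀ᵐ ω ∂P, Tendsto (fun n => empiricalMeasure (fun i => X i ω) n s) atTop (𝓝 (Q s)) := by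
  filter_upwards [ae_tendsto_average hX hlaw hindep (measurable_const.indicator hs)
    ((integrable_const (1 : ℝ)).indicator hs)] with ω hω
  have h := ENNReal.tendsto_ofReal hω
  rw [integral_indicator_const _ hs, smul_eq_mul, mul_one, ofReal_measureReal] at h
  refine h.congr' ?_
  filter_upwards [eventually_ne_atTop 0] with n hn
  exact (empiricalMeasure_apply _ hn hs).symm

/-- Almost surely the empirical measures converge weakly to the common law, in the form of the
lower bound on all open sets. -/
theorem ae_forall_isOpen_le_liminf_empiricalMeasure {Ω E : Type*} [MeasurableSpace Ω]
    [TopologicalSpace E] [SecondCountableTopology E] [MeasurableSpace E] [BorelSpace E]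
    {P : Measure Ω} {Q : Measure E} [IsFiniteMeasure Q] {X : ℕ → Ω → E}
    (hX : ∀ i, Measurable (X i)) (hlaw : ∀ i, P.map (X i) = Q)
    (hindep : Pairwise fun i j => IndepFun (X i) (X j) P) :
    ∀ᵐ ω ∂P, ∀ G : Set E, IsOpen G →
      Q G ≤ liminf (fun n => empiricalMeasure (fun i => X i ω) n G) atTop := by
  set B := TopologicalSpace.countableBasis E
  have hBc : B.Countable := TopologicalSpace.countable_countableBasis E
  have hBo : ∀ b ∈ B, IsOpen b := fun b hb => TopologicalSpace.isOpen_of_mem_countableBasis hb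
  -- Finite unions of basic sets are countable in number, and every open set is a directed union of
  -- them; this gives one null set for all open sets.
  have hall : ∀ᵐ ω ∂P, ∀ F ∈ {F : Set (Set E) | F.Finite ∧ F ⊆ B},
      Tendsto (fun n => empiricalMeasure (fun i => X i ω) n (⋃₀ F)) atTop (𝓝 (Q (⋃₀ F))) := by
    rw [ae_ball_iff (Set.countable_ofPred_finite_subset hBc)]
    intro F hF
    exact ae_tendsto_empiricalMeasure hX hlaw hindep
      (isOpen_sUnion fun b hb => hBo b (hF.2 hb)).measurableSet
  filter_upwards [hall] with ω hω G hG
  let S : Set (Set E) := {b ∈ B | b ⊆ G}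
  have hS : Countable S := (hBc.mono (Set.sep_subset _ _)).to_subtype
  let A : Finset S → Set E := fun F => ⋃₀ ((fun b : S => (b : Set E)) '' (F : Set S))
  have hAG : ⋃ F, A F = G := by
    refine Set.Subset.antisymm ?_ ?_
    · refine Set.iUnion_subset fun F => Set.sUnion_subset ?_
      rintro _ ⟨b, -, rfl⟩
      exact b.2.2
    · intro x hx
      obtain ⟨b, hb, hxb, hbG⟩ :=
        (TopologicalSpace.isBasis_countableBasis E).exists_subset_of_mem_open hx hG
      refine Set.mem_iUnion.2 ⟨{⟨b, hb, hbG⟩}, b, ⟨⟨b, hb, hbG⟩, by simp, rfl⟩, hxb⟩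
  have hmono : Monotone A := fun F F' h => Set.sUnion_subset_sUnion
    (Set.image_mono (Finset.coe_subset.2 h))
  rw [← hAG, hmono.directed_le.measure_iUnion]
  refine iSup_le fun F => ?_
  have hF := hω ((fun b : S => (b : Set E)) '' (F : Set S))
    ⟨F.finite_toSet.image _, by rintro _ ⟨b, -, rfl⟩; exact b.2.1⟩
  rw [← hF.liminf_eq]
  exact liminf_le_liminf (Eventually.of_forall fun n => measure_mono (Set.subset_iUnion A F))

/-! ### Fatou's lemma for varying measures. -/

/-- A modulus of continuity common to the family passes to its infimum; the bound `h0` makes the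
real infimum a genuine one. -/
theorem Equicontinuous.continuous_iInf {X ι : Type*} [TopologicalSpace X] [Nonempty ι]
    {g : ι → X → ℝ} (hg : Equicontinuous g) (h0 : ∀ i x, 0 ≤ g i x) :
    Continuous fun x => ⨅ i, g i x := by
  have hb : ∀ x, BddBelow (Set.range fun i => g i x) := fun x =>
    ⟨0, by rintro _ ⟨i, rfl⟩; exact h0 i x⟩
  refine continuous_iff_continuousAt.2 fun x₀ => Metric.tendsto_nhds.2 fun r hr => ?_
  filter_upwards [Metric.equicontinuousAt_iff_right.1 (hg x₀) (r / 2) (half_pos hr)] with x hx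
  have key : ∀ a b : X, (∀ i, g i a ≤ g i b + r / 2) → ⨅ i, g i a ≤ (⨅ i, g i b) + r / 2 := by
    intro a b hab
    rw [← sub_le_iff_le_add]
    exact le_ciInf fun i => sub_le_iff_le_add.2 ((ciInf_le (hb a) i).trans (hab i))
  have h1 := key x x₀ fun i => by
    have := abs_lt.1 (Real.dist_eq _ _ ▸ hx i); linarith
  have h2 := key x₀ x fun i => by
    have := abs_lt.1 (Real.dist_eq _ _ ▸ hx i); linarith
  rw [Real.dist_eq, abs_lt]
  constructor <;> linarith

/-- Fatou's lemma along weakly converging measures, for an equicontinuous sequence of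
integrands. -/
theorem lintegral_le_liminf_of_equicontinuous {E : Type*} [TopologicalSpace E] [MeasurableSpace E]
    [OpensMeasurableSpace E] {Q : Measure E} {Qs : ℕ → Measure E}
    (hQ : ∀ G, IsOpen G → Q G ≤ liminf (fun n => Qs n G) atTop)
    {g : ℕ → E → ℝ} {f : E → ℝ} (hg : Equicontinuous g) (h0 : ∀ n z, 0 ≤ g n z)
    (hlim : ∀ z, Tendsto (fun n => g n z) atTop (𝓝 (f z))) :
    ∫⁻ z, ENNReal.ofReal (f z ^ 2) ∂Q
      ≤ liminf (fun n => ∫⁻ z, ENNReal.ofReal (g n z ^ 2) ∂(Qs n)) atTop := by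
  -- The tail infima are continuous and increase to `f`: weak convergence handles each fixed `h N`,
  -- and monotone convergence then lets `N → ∞`.
  let h : ℕ → E → ℝ := fun N z => ⨅ k, g (N + k) z
  have hb : ∀ N z, BddBelow (Set.range fun k => g (N + k) z) := fun N z =>
    ⟨0, by rintro _ ⟨i, rfl⟩; exact h0 _ z⟩
  have hh0 : ∀ N z, 0 ≤ h N z := fun N z => le_ciInf fun k => h0 _ z
  have hc : ∀ N, Continuous (h N) := fun N =>
    Equicontinuous.continuous_iInf (hg.comp fun k => N + k) fun k z => h0 _ z
  have hle : ∀ N n, N ≤ n → ∀ z, h N z ≤ g n z := fun N n hn z => by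
    obtain ⟨k, rfl⟩ := Nat.exists_eq_add_of_le hn
    exact ciInf_le (hb N z) k
  have hmono : ∀ z, Monotone fun N => h N z := fun z N M hNM =>
    le_ciInf fun k => hle N (M + k) (by omega) z
  have htend : ∀ z, Tendsto (fun N => h N z) atTop (𝓝 (f z)) := fun z => by
    refine Metric.tendsto_atTop.2 fun r hr => ?_
    obtain ⟨N, hN⟩ := Metric.tendsto_atTop.1 (hlim z) (r / 2) (half_pos hr)
    refine ⟨N, fun n hn => ?_⟩
    have h1 := abs_lt.1 (Real.dist_eq _ _ ▸ hN n hn)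
    have h2 := hle n n le_rfl z
    have h3 : f z - r / 2 ≤ h n z := le_ciInf fun k => by
      have := abs_lt.1 (Real.dist_eq _ _ ▸ hN (n + k) (by omega)); linarith
    rw [Real.dist_eq, abs_lt]
    constructor <;> linarith
  have hlint : Tendsto (fun N => ∫⁻ z, ENNReal.ofReal (h N z ^ 2) ∂Q) atTop
      (𝓝 (∫⁻ z, ENNReal.ofReal (f z ^ 2) ∂Q)) := by
    refine lintegral_tendsto_of_tendsto_of_monotone
      (fun N => ((hc N).pow 2).measurable.ennreal_ofReal.aemeasurable)
      (Eventually.of_forall fun z N M hNM => ?_)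
      (Eventually.of_forall fun z => ENNReal.tendsto_ofReal ((htend z).pow 2))
    exact ENNReal.ofReal_le_ofReal (pow_le_pow_left₀ (hh0 N z) (hmono z hNM) 2)
  refine le_of_tendsto' hlint fun N => ?_
  refine (lintegral_le_liminf_lintegral_of_forall_isOpen_measure_le_liminf_measure
    ((hc N).pow 2) (fun z => sq_nonneg _) hQ).trans ?_
  refine liminf_le_liminf ?_
  filter_upwards [eventually_ge_atTop N] with n hn
  exact lintegral_mono fun z => ENNReal.ofReal_le_ofReal
    (pow_le_pow_left₀ (hh0 N z) (hle N n hn z) 2)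

/-! ### Diagonal sequences, independence of pairs, graph-norm density. -/

/-- A diagonal sequence: if `a k n → b k` as `n → ∞` for every `k`, then along some `κ n → ∞` the
terms `a (κ n) n` and `b (κ n)` become arbitrarily close. -/
theorem exists_tendsto_atTop_diagonal (a : ℕ → ℕ → ℝ) (b : ℕ → ℝ)
    (h : ∀ k, Tendsto (a k) atTop (𝓝 (b k))) :
    ∃ κ : ℕ → ℕ, Tendsto κ atTop atTop ∧
      Tendsto (fun n => a (κ n) n - b (κ n)) atTop (𝓝 0) := by
  classical
  let p : ℕ → ℕ → Prop := fun n k => |a k n - b k| ≤ 1 / ((k : ℝ) + 1)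
  have hp : ∀ k, ∀ᶠ n in atTop, p n k := fun k => by
    filter_upwards [Metric.tendsto_nhds.1 (h k) (1 / ((k : ℝ) + 1)) (by positivity)] with n hn
    exact (Real.dist_eq _ _ ▸ hn).le
  let κ : ℕ → ℕ := fun n => Nat.findGreatest (p n) n
  have hκ : Tendsto κ atTop atTop := tendsto_atTop.2 fun K => by
    filter_upwards [hp K, eventually_ge_atTop K] with n hn hK
    exact Nat.le_findGreatest hK hn
  refine ⟨κ, hκ, ?_⟩
  refine squeeze_zero_norm' ?_ (tendsto_one_div_add_atTop_nhds_zero_nat.comp hκ)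
  -- Once `p n 0` holds, the default value `0` of `Nat.findGreatest` satisfies `p n` as well.
  filter_upwards [hp 0] with n hn
  exact Nat.findGreatest_spec (P := p n) (Nat.zero_le n) hn

/-- If two sequences of independent random elements are independent of each other,
then the paired sequence is pairwise independent. -/
theorem ProbabilityTheory.IndepFun.pairwise_indepFun_prodMk {Ω E F : Type*} [MeasurableSpace Ω]
    [MeasurableSpace E] [MeasurableSpace F] {P : Measure Ω} [IsProbabilityMeasure P]
    {t : ℕ → Ω → E} {e : ℕ → Ω → F} (ht : ∀ i, Measurable (t i)) (he : ∀ i, Measurable (e i))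
    (hti : iIndepFun t P) (hei : iIndepFun e P)
    (h : IndepFun (fun ω i => t i ω) (fun ω i => e i ω) P) :
    Pairwise fun i j => IndepFun (fun ω => (t i ω, e i ω)) (fun ω => (t j ω, e j ω)) P := by
  intro i j hij
  -- Independence need only be checked on the π-system of rectangles, where the `t` and `e` events
  -- separate.
  have hte : ∀ s₁ s₂ : Set E, ∀ u₁ u₂ : Set F, MeasurableSet s₁ → MeasurableSet s₂ →
      MeasurableSet u₁ → MeasurableSet u₂ →
      P ((t i ⁻¹' s₁ ∩ t j ⁻¹' s₂) ∩ (e i ⁻¹' u₁ ∩ e j ⁻¹' u₂))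
        = P (t i ⁻¹' s₁) * P (t j ⁻¹' s₂) * (P (e i ⁻¹' u₁) * P (e j ⁻¹' u₂)) := by
    intro s₁ s₂ u₁ u₂ hs₁ hs₂ hu₁ hu₂
    rw [← (hti.indepFun hij).measure_inter_preimage_eq_mul _ _ hs₁ hs₂,
      ← (hei.indepFun hij).measure_inter_preimage_eq_mul _ _ hu₁ hu₂]
    exact h.measure_inter_preimage_eq_mul
      ((fun x : ℕ → E => x i) ⁻¹' s₁ ∩ (fun x : ℕ → E => x j) ⁻¹' s₂)
      ((fun x : ℕ → F => x i) ⁻¹' u₁ ∩ (fun x : ℕ → F => x j) ⁻¹' u₂)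
      ((measurable_pi_apply i hs₁).inter (measurable_pi_apply j hs₂))
      ((measurable_pi_apply i hu₁).inter (measurable_pi_apply j hu₂))
  have hmarg : ∀ k, ∀ s : Set E, ∀ u : Set F, MeasurableSet s → MeasurableSet u →
      P (t k ⁻¹' s ∩ e k ⁻¹' u) = P (t k ⁻¹' s) * P (e k ⁻¹' u) := by
    intro k s u hs hu
    exact h.measure_inter_preimage_eq_mul ((fun x : ℕ → E => x k) ⁻¹' s)
      ((fun x : ℕ → F => x k) ⁻¹' u) (measurable_pi_apply k hs) (measurable_pi_apply k hu)
  have hm : ∀ k, Measurable fun ω => (t k ω, e k ω) := fun k => (ht k).prodMk (he k)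
  rw [IndepFun_iff_Indep]
  have hgen : ∀ k, MeasurableSpace.comap (fun ω => (t k ω, e k ω)) inferInstance
      = MeasurableSpace.generateFrom (Set.preimage (fun ω => (t k ω, e k ω)) ''
        Set.image2 (· ×ˢ ·) {s : Set E | MeasurableSet s} {u : Set F | MeasurableSet u}) :=
    fun k => by rw [← MeasurableSpace.comap_generateFrom, generateFrom_prod]
  refine IndepSets.indep (hm i).comap_le (hm j).comap_le (isPiSystem_prod.comap _)
    (isPiSystem_prod.comap _) (hgen i) (hgen j) ?_
  rw [IndepSets_iff]
  rintro _ _ ⟨_, ⟨s₁, hs₁, u₁, hu₁, rfl⟩, rfl⟩ ⟨_, ⟨s₂, hs₂, u₂, hu₂, rfl⟩, rfl⟩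
  simp only [Set.mk_preimage_prod]
  rw [Set.inter_inter_inter_comm, hte s₁ s₂ u₁ u₂ hs₁ hs₂ hu₁ hu₂, hmarg i s₁ u₁ hs₁ hu₁,
    hmarg j s₂ u₂ hs₂ hu₂, mul_mul_mul_comm]


/-- A family of functions indexed by a second countable metric space has a countable subfamily of
square integrable members that is dense, for the graph norm, among all square integrable
members. -/
theorem exists_countable_dense_memLp_two {H E : Type*} [PseudoMetricSpace H]
    [SecondCountableTopology H] [MeasurableSpace E] (Q : Measure E) [IsSeparable Q]
    (r : H → E → ℝ) :
    ∃ S : Set H, S.Countable ∧ (∀ s ∈ S, MemLp (r s) 2 Q) ∧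
      ∀ v, MemLp (r v) 2 Q → ∃ s : ℕ → H, (∀ k, s k ∈ S) ∧ Tendsto s atTop (𝓝 v) ∧
        Tendsto (fun k => ∫ z, r (s k) z ^ 2 ∂Q) atTop (𝓝 (∫ z, r v z ^ 2 ∂Q)) := by
  have : Fact ((1 : ENNReal) ≤ 2) := ⟨one_le_two⟩
  have : Fact ((2 : ENNReal) ≠ ⊤) := ⟨ENNReal.ofNat_ne_top⟩
  let D := {v : H // MemLp (r v) 2 Q}
  let Φ : D → H × Lp ℝ 2 Q := fun v => (v.1, v.2.toLp (r v.1))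
  -- The graph topology: it inherits second countability from `H × L²`.
  let τ : TopologicalSpace D := TopologicalSpace.induced Φ inferInstance
  have hΦ : IsInducing Φ := ⟨rfl⟩
  have : SecondCountableTopology D := hΦ.secondCountableTopology
  have hnorm : ∀ v : D, ‖(Φ v).2‖ ^ 2 = ∫ z, r v.1 z ^ 2 ∂Q := by
    intro v
    rw [← real_inner_self_eq_norm_sq, L2.inner_def]
    refine integral_congr_ae ?_
    filter_upwards [v.2.coeFn_toLp] with z hz
    simp [Φ, hz, sq]
  obtain ⟨S, hSc, hSd⟩ := TopologicalSpace.exists_countable_dense D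
  refine ⟨Subtype.val '' S, hSc.image _, ?_, fun v hv => ?_⟩
  · rintro _ ⟨s, -, rfl⟩
    exact s.2
  · obtain ⟨s, hs, hlim⟩ := mem_closure_iff_seq_limit.1 (hSd ⟨v, hv⟩)
    have h : Tendsto (fun k => Φ (s k)) atTop (𝓝 (Φ ⟨v, hv⟩)) :=
      (hΦ.continuous.tendsto _).comp hlim
    refine ⟨fun k => (s k).1, fun k => ⟨_, hs k, rfl⟩, (continuous_fst.tendsto _).comp h, ?_⟩
    have h2 := (((continuous_snd.tendsto _).comp h).norm).pow 2
    rw [hnorm] at h2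
    exact h2.congr fun k => hnorm _

/-! ### Weak convergence. -/

theorem WeaklyConverges.tendsto_apply {E : Type*} [NormedAddCommGroup E] [NormedSpace ℝ E]
    {u : ℕ → E} {x : E} (h : WeaklyConverges u x) (l : E →L[ℝ] ℝ) :
    Tendsto (fun n => l (u n)) atTop (𝓝 (l x)) :=
  ((WeakBilin.eval_continuous (topDualPairing ℝ E).flip l).tendsto _).comp h

theorem weaklyConverges_of_tendsto {E : Type*} [NormedAddCommGroup E] [NormedSpace ℝ E]
    {u : ℕ → E} {x : E} (h : Tendsto u atTop (𝓝 x)) : WeaklyConverges u x :=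
  ((toWeakSpaceCLM ℝ E).continuous.tendsto x).comp h

/-- Weakly convergent sequences in a Hilbert space are bounded. -/
theorem WeaklyConverges.exists_norm_le {H : Type*} [NormedAddCommGroup H] [InnerProductSpace ℝ H]
    [CompleteSpace H] {u : ℕ → H} {x : H} (h : WeaklyConverges u x) : ∃ C, ∀ n, ‖u n‖ ≤ C := by
  obtain ⟨C, hC⟩ := banach_steinhaus (g := fun n => innerSL ℝ (u n)) fun z => by
    obtain ⟨M, hM⟩ := (h.tendsto_apply (innerSL ℝ z)).norm.bddAbove_range
    refine ⟨M, fun n => ?_⟩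
    have := hM ⟨n, rfl⟩
    simpa [real_inner_comm] using this
  exact ⟨C, fun n => by simpa using hC n⟩

/-! ### Residuals and the two halves of Γ-convergence. -/

/-- The residual of the candidate `v` at an index `z.1` and a noise value `z.2`. -/
noncomputable def splineResidual {H : Type*} [NormedAddCommGroup H] [InnerProductSpace ℝ H] {T : Type*}
    (L : T → H →L[ℝ] ℝ) (μdag v : H) (z : T × ℝ) : ℝ :=
  z.2 + L z.1 (μdag - v)

section SplineResidual

variable {H : Type*} [NormedAddCommGroup H] [InnerProductSpace ℝ H] {T : Type*}
  {L : T → H →L[ℝ] ℝ} {μdag : H}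

theorem continuous_splineResidual [TopologicalSpace T] (hL : Continuous L) (v : H) :
    Continuous (splineResidual L μdag v) := by
  unfold splineResidual
  fun_prop

theorem splineFunctional_eq_splineResidual (H₁ : Submodule ℝ H) [CompleteSpace H₁] (n : ℕ) (lam : ℝ)
    {t : ℕ → T} {y e : ℕ → ℝ} (hy : ∀ i, y i = L (t i) μdag + e i) (v : H) :
    splineFunctional H₁ L n lam t y v
      = (∑ i ∈ Finset.range n, splineResidual L μdag v (t i, e i) ^ 2) / n
        + lam * ‖H₁.starProjection v‖ ^ 2 := by
  have h : ∀ i, y i - L (t i) v = splineResidual L μdag v (t i, e i) := fun i => by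
    rw [hy, splineResidual, map_sub]; ring
  simp only [splineFunctional, h]
  ring

/-- Tonelli, after the substitution `y = L t μ† + e`. -/
theorem splineLimit_eq_lintegral_splineResidual [TopologicalSpace T] [SecondCountableTopology T]
    [MeasurableSpace T] [BorelSpace T] (hL : Continuous L) (φT : Measure T) (φ₀ : Measure ℝ)
    [SFinite φ₀] (v : H) :
    splineLimit L φT φ₀ μdag v
      = ((∫⁻ z, ENNReal.ofReal (splineResidual L μdag v z ^ 2) ∂(φT.prod φ₀) : ENNReal) : EReal) := by
  rw [splineLimit, lintegral_prod _
    ((continuous_splineResidual hL v).measurable.pow_const 2).ennreal_ofReal.aemeasurable]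
  congr 2 with a
  rw [shiftedLaw, lintegral_map (by fun_prop) (by fun_prop)]
  refine lintegral_congr fun e => ?_
  rw [sq_abs, splineResidual, map_sub]
  ring_nf

theorem equicontinuous_abs_splineResidual [TopologicalSpace T] (hL : Continuous L) {u : ℕ → H} {C : ℝ}
    (hu : ∀ n, ‖u n‖ ≤ C) : Equicontinuous fun n z => |splineResidual L μdag (u n) z| := by
  intro z₀
  refine Metric.equicontinuousAt_of_continuity_modulus
    -- This modulus uses `‖u n‖ ≤ C` only, so it is the same for all `n`.
    (fun z => |z₀.2 - z.2| + ‖L z₀.1 - L z.1‖ * (‖μdag‖ + C)) ?_ _ (Eventually.of_forall ?_)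
  · have : Continuous fun z : T × ℝ => |z₀.2 - z.2| + ‖L z₀.1 - L z.1‖ * (‖μdag‖ + C) := by
      fun_prop
    simpa using this.tendsto z₀
  · intro z n
    rw [Real.dist_eq]
    refine (abs_abs_sub_abs_le _ _).trans ?_
    have h : splineResidual L μdag (u n) z₀ - splineResidual L μdag (u n) z
        = (z₀.2 - z.2) + (L z₀.1 - L z.1) (μdag - u n) := by
      simp only [splineResidual, sub_apply]; ring
    rw [h]
    refine (abs_add_le _ _).trans (add_le_add le_rfl ?_)
    refine ((L z₀.1 - L z.1).le_opNorm _).trans ?_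
    gcongr
    exact (norm_sub_le _ _).trans (by gcongr; exact hu n)

/-- The lower bound of `Γ`-convergence, at a sample whose empirical measures converge weakly. -/
theorem splineLimit_le_liminf_splineFunctional [CompleteSpace H] [TopologicalSpace T]
    [SecondCountableTopology T] [MeasurableSpace T] [BorelSpace T] (hL : Continuous L)
    {φT : Measure T} {φ₀ : Measure ℝ} [SFinite φ₀] (H₁ : Submodule ℝ H) [CompleteSpace H₁]
    {lam : ℕ → ℝ} (hlam : ∀ n, 0 ≤ lam n) {t : ℕ → T} {y e : ℕ → ℝ}
    (hy : ∀ i, y i = L (t i) μdag + e i)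
    (hopen : ∀ G, IsOpen G → φT.prod φ₀ G
      ≤ liminf (fun n => empiricalMeasure (fun i => (t i, e i)) n G) atTop)
    {u : ℕ → H} {v : H} (hu : WeaklyConverges u v) :
    splineLimit L φT φ₀ μdag v
      ≤ liminf (fun n => ((splineFunctional H₁ L n (lam n) t y (u n) : ℝ) : EReal)) atTop := by
  obtain ⟨C, hC⟩ := hu.exists_norm_le
  have h := lintegral_le_liminf_of_equicontinuous hopen
    (equicontinuous_abs_splineResidual (μdag := μdag) hL hC) (fun n z => abs_nonneg _)
    (f := fun z => |splineResidual L μdag v z|) fun z => by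
      simp only [splineResidual, map_sub]
      exact (tendsto_const_nhds.add (tendsto_const_nhds.sub (hu.tendsto_apply _))).abs
  simp only [sq_abs] at h
  rw [splineLimit_eq_lintegral_splineResidual hL]
  refine (EReal.coe_ennreal_le_coe_ennreal_iff.2 h).trans ?_
  rw [Monotone.map_liminf_of_continuousAt (f := ((↑) : ENNReal → EReal))
    (fun a b hab => EReal.coe_ennreal_le_coe_ennreal_iff.2 hab) _
    continuous_coe_ennreal_ereal.continuousAt]
  refine liminf_le_liminf ?_
  filter_upwards [eventually_ne_atTop 0] with n hn
  rw [Function.comp_apply, lintegral_empiricalMeasure _ hn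
    ((continuous_splineResidual hL _).measurable.pow_const 2) (fun z => sq_nonneg _), EReal.coe_ennreal_ofReal,
    max_eq_left (div_nonneg (Finset.sum_nonneg fun _ _ => sq_nonneg _) n.cast_nonneg),
    splineFunctional_eq_splineResidual H₁ n _ hy, EReal.coe_le_coe_iff]
  exact le_add_of_nonneg_right (mul_nonneg (hlam n) (sq_nonneg _))

/-- The recovery sequence of `Γ`-convergence, at a sample that satisfies the law of large numbers on
a family of candidates dense in the graph norm. -/
theorem exists_limsup_splineFunctional_le [TopologicalSpace T]
    [SecondCountableTopology T] [MeasurableSpace T] [BorelSpace T] (hL : Continuous L)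
    {φT : Measure T} {φ₀ : Measure ℝ} [SFinite φ₀] (H₁ : Submodule ℝ H) [CompleteSpace H₁]
    {lam : ℕ → ℝ} (hlam : Tendsto lam atTop (𝓝 0)) {t : ℕ → T} {y e : ℕ → ℝ}
    (hy : ∀ i, y i = L (t i) μdag + e i) {S : Set H}
    (hS : ∀ v, MemLp (splineResidual L μdag v) 2 (φT.prod φ₀) → ∃ s : ℕ → H, (∀ k, s k ∈ S) ∧
      Tendsto s atTop (𝓝 v) ∧ Tendsto (fun k => ∫ z, splineResidual L μdag (s k) z ^ 2 ∂(φT.prod φ₀))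
        atTop (𝓝 (∫ z, splineResidual L μdag v z ^ 2 ∂(φT.prod φ₀))))
    (hlln : ∀ s ∈ S, Tendsto
      (fun n : ℕ => (∑ i ∈ Finset.range n, splineResidual L μdag s (t i, e i) ^ 2) / n) atTop
      (𝓝 (∫ z, splineResidual L μdag s z ^ 2 ∂(φT.prod φ₀)))) (v : H) :
    ∃ u : ℕ → H, WeaklyConverges u v ∧
      limsup (fun n => ((splineFunctional H₁ L n (lam n) t y (u n) : ℝ) : EReal)) atTop
        ≤ splineLimit L φT φ₀ μdag v := by
  have hmeas := (continuous_splineResidual (μdag := μdag) hL v).measurable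
  rw [splineLimit_eq_lintegral_splineResidual hL]
  by_cases htop : ∫⁻ z, ENNReal.ofReal (splineResidual L μdag v z ^ 2) ∂(φT.prod φ₀) = ⊤
  · exact ⟨fun _ => v, weaklyConverges_of_tendsto tendsto_const_nhds, by simp [htop]⟩
  have hint : Integrable (fun z => splineResidual L μdag v z ^ 2) (φT.prod φ₀) :=
    (lintegral_ofReal_ne_top_iff_integrable (hmeas.pow_const 2).aestronglyMeasurable
      (Eventually.of_forall fun z => sq_nonneg _)).1 htop
  obtain ⟨s, hsS, hsv, hslim⟩ :=
    hS v ((memLp_two_iff_integrable_sq hmeas.aestronglyMeasurable).2 hint)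
  -- For fixed `k` the limit is the integral plus `0 * ‖H₁.starProjection (s k)‖ ^ 2`.
  obtain ⟨κ, hκ, hdiag⟩ := exists_tendsto_atTop_diagonal
    (fun k n => splineFunctional H₁ L n (lam n) t y (s k)) _ fun k => by
      simp only [splineFunctional_eq_splineResidual H₁ _ _ hy]
      exact (hlln _ (hsS k)).add (hlam.mul_const (‖H₁.starProjection (s k)‖ ^ 2))
  refine ⟨fun n => s (κ n), weaklyConverges_of_tendsto (hsv.comp hκ), le_of_eq ?_⟩
  have h := hdiag.add (hslim.comp hκ)
  rw [← ofReal_integral_eq_lintegral_ofReal hint (Eventually.of_forall fun z => sq_nonneg _),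
    EReal.coe_ennreal_ofReal, max_eq_left (integral_nonneg fun z => sq_nonneg _)]
  simp only [Function.comp_def, zero_mul, add_zero, zero_add, sub_add_cancel] at h
  exact ((continuous_coe_real_ereal.tendsto _).comp h).limsup_eq

end SplineResidual

theorem mainTheorem3
    -- the separable Hilbert space `H = H₀ ⊕ H₁` (orthogonal sum)
    {H : Type*} [NormedAddCommGroup H] [InnerProductSpace ℝ H] [CompleteSpace H]
    [TopologicalSpace.SeparableSpace H]
    (m : ℕ) (H₀ H₁ : Submodule ℝ H) [CompleteSpace H₁]
    (hcompl : IsCompl H₀ H₁) (hortho : H₀ ⟂ H₁)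
    (hfin : FiniteDimensional ℝ H₀) (hdim : Module.finrank ℝ H₀ = m)
    (hinf : ¬ FiniteDimensional ℝ H₁)
    -- the family of observation operators, continuous in the operator norm
    (d : ℕ) (I : Set (EuclideanSpace ℝ (Fin d))) (L : I → H →L[ℝ] ℝ) (hL : Continuous L)
    -- the law of the index and the centered noise law with variance `σ ^ 2`
    (φT : Measure I) [IsProbabilityMeasure φT]
    (φ₀ : Measure ℝ) [IsProbabilityMeasure φ₀] (σ : ℝ)
    (hφ₀ : MemLp id 2 φ₀) (hmean : ∫ e, e ∂φ₀ = 0) (hvar : variance id φ₀ = σ ^ 2)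
    -- the general spline model
    {Ω : Type*} [MeasurableSpace Ω] (P : Measure Ω) [IsProbabilityMeasure P]
    (t : ℕ → Ω → I) (ε : ℕ → Ω → ℝ)
    (ht_meas : ∀ i, Measurable (t i)) (hε_meas : ∀ i, Measurable (ε i))
    (ht_law : ∀ i, P.map (t i) = φT) (hε_law : ∀ i, P.map (ε i) = φ₀)
    (ht_indep : iIndepFun t P) (hε_indep : iIndepFun ε P)
    (htε_indep : IndepFun (fun ω i => t i ω) (fun ω i => ε i ω) P)
    (μdag : H) (y : ℕ → Ω → ℝ) (hy : ∀ i ω, y i ω = L (t i ω) μdag + ε i ω)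
    -- the scaling `λ_n = n ^ (-p)`
    (p : ℝ) (hp : 0 < p) (hp' : p ≤ 1 / 2) :
    ∀ᵐ ω ∂P,
      GammaConverges
        (fun n μ => ((splineFunctional H₁ L n ((n : ℝ) ^ (-p))
          (fun i => t i ω) (fun i => y i ω) μ : ℝ) : EReal))
        (splineLimit L φT φ₀ μdag) := by
  have hindep := htε_indep.pairwise_indepFun_prodMk ht_meas hε_meas ht_indep hε_indep
  have hX : ∀ i, Measurable fun ω => (t i ω, ε i ω) := fun i => (ht_meas i).prodMk (hε_meas i)
  have hlaw : ∀ i, P.map (fun ω => (t i ω, ε i ω)) = φT.prod φ₀ := fun i => by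
    rw [← ht_law i, ← hε_law i]
    exact (htε_indep.comp (measurable_pi_apply i) (measurable_pi_apply i)).map_prod_eq_prod_map_map
      (ht_meas i).aemeasurable (hε_meas i).aemeasurable
  have : SecondCountableTopology H := UniformSpace.secondCountable_of_separable H
  obtain ⟨S, hSc, hSmem, hS⟩ :=
    exists_countable_dense_memLp_two (φT.prod φ₀) (splineResidual L μdag)
  have hlln : ∀ᵐ ω ∂P, ∀ s ∈ S, Tendsto
      (fun n : ℕ => (∑ i ∈ Finset.range n, splineResidual L μdag s (t i ω, ε i ω) ^ 2) / n) atTop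
      (𝓝 (∫ z, splineResidual L μdag s z ^ 2 ∂(φT.prod φ₀))) :=
    (ae_ball_iff hSc).2 fun s hs => ae_tendsto_average hX hlaw hindep
      ((continuous_splineResidual hL s).measurable.pow_const 2) (hSmem s hs).integrable_sq
  filter_upwards [ae_forall_isOpen_le_liminf_empiricalMeasure hX hlaw hindep, hlln]
    with ω hopen hω v
  exact ⟨fun u hu => splineLimit_le_liminf_splineFunctional hL H₁
      (fun n => Real.rpow_nonneg n.cast_nonneg _) (fun i => hy i ω) hopen hu,
    exists_limsup_splineFunctional_le hL H₁
      ((tendsto_rpow_neg_atTop hp).comp tendsto_natCast_atTop_atTop) (fun i => hy i ω) hS hω v⟩
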